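/- Let $S$ be a countable set and, for $p\in(0,\infty)$, let $\Phi_p$ be the $p$-Fréchet distribution function, $\Phi_p(x)=\exp(-x^{-p})$ for $x>0$ and $\Phi_p(x)=0$ for $x\le 0$; put $\Phi_\infty=\mathbf 1_{[1,\infty)}$ (the weak limit of $\Phi_p$ as $p\to\infty$). A real-valued process $X=\{X(s)\}_{s\in S}$ is called max-stable if there are functions $a_n:S\to(0,\infty)$ and $b_n:S\to\mathbb R$ such that, for every $n\ge 1$, $X$ has the same law as $\max_{i=1}^n (X_i-b_n)/a_n$ (pointwise maximum), where $X_1,\dots,X_n$ are independent copies of $X$; it is simple max-stable if moreover $X(s)\sim\Phi_1$ for all $s\in S$. Let $p\in(1,\infty]$. Let $\{U^{(p)}(s)\}_{s\in S}$ be a collection of independent random variables with distribution function $\Phi_p$, let $\sum_{i\in\mathbb N}\delta_{A_i}$ be a Poisson point process on $(0,\infty)$ with intensity $a^{-2}\,da$, and let $W_i$, $i\in\mathbb N$, be independent copies of a (almost surely) nonnegative stochastic process $\{W(s)\}_{s\in S}$ with $\mathbb E\,W(s)=1$ for all $s\in S$. Assume that the noise $U^{(p)}$, the sequence $(A_i)_{i\in\mathbb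 N}$ and the sequence $(W_i)_{i\in\mathbb N}$ are mutually independent. Let $\|\cdot\|_p$ denote the $\ell^p$ norm (the supremum norm if $p=\infty$) and let $\mathbf A\circ\mathbf W(s)=(A_iW_i(s))_{i\in\mathbb N}$. Then, for every $s\in S$, $\|\mathbf A\circ\mathbf W(s)\|_p<\infty$ almost surely, and the process $$X(s)=\frac{U^{(p)}(s)}{\Gamma(1-p^{-1})}\,\|\mathbf A\circ\mathbf W(s)\|_p,\qquad s\in S$$ (with $p^{-1}=0$ for $p=\infty$), is simple max-stable. Moreover, for all $n\in\mathbb N$, all pairwise distinct $s_1,\dots,s_n\in S$ and all $x_1,\dots,x_n>0$, the expectation below is finite and $$\mathbb P\bigl(X(s_i)\le x_i,\ i=1,\dots,n\bigr)=\exp\Bigl(-\mathbb E\,\Bigl\|\Bigl(\frac{W(s_i)}{x_i}\Bigr)_{i=1}^n\Bigr\|_p\Bigr).$$ -/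

import Mathlib

open MeasureTheory ProbabilityTheory Set
open scoped ENNReal NNReal

noncomputable section

namespace LpMaxStable

/-- The `ℓ^p` norm, `1 ≤ p ≤ ∞`, of a real family, as an element of `[0, ∞]`. -/
def ellNorm {ι : Type*} (p : ℝ≥0∞) (x : ι → ℝ) : ℝ≥0∞ :=
  if p = ∞ then ⨆ i, ‖x i‖ₑ else (∑' i, ‖x i‖ₑ ^ p.toReal) ^ (1 / p.toReal)

/-- The distribution function of the `p`-Fréchet law, `0 < p ≤ ∞`:
`exp (-x ^ (-p))` for `x > 0` and `0` for `x ≤ 0` if `p < ∞`;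
for `p = ∞` the weak limit as `p → ∞`, which is the unit mass at `1`. -/
def frechetCDF (p : ℝ≥0∞) (x : ℝ) : ℝ :=
  if p = ∞ then (Ici (1 : ℝ)).indicator 1 x
  else (Ioi (0 : ℝ)).indicator (fun y => Real.exp (-y ^ (-p.toReal))) x

/-- The real random variable `Y` has the `p`-Fréchet distribution. -/
structure IsFrechet {Ω : Type*} [MeasurableSpace Ω] (p : ℝ≥0∞) (Y : Ω → ℝ)
    (P : Measure Ω) : Prop where
  measurable : Measurable Y
  cdf_eq : ∀ x : ℝ, P.real {ω | Y ω ≤ x} = frechetCDF p x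

/-- The random counting measure `∑ i, δ_{A i}`. -/
def pointMeasure {Ω E : Type*} [MeasurableSpace E] (A : ℕ → Ω → E) (ω : Ω) : Measure E :=
  Measure.sum fun i => Measure.dirac (A i ω)

/-- `∑ i, δ_{A i}` is a Poisson point process with intensity measure `Λ`: the number of points in
a measurable set `B` is Poisson distributed with mean `Λ B` (almost surely infinite if `Λ B = ∞`),
and the numbers of points in finitely many pairwise disjoint measurable sets are independent. -/
structure IsPoissonProcess {Ω E : Type*} [MeasurableSpace Ω] [MeasurableSpace E]
    (A : ℕ → Ω → E) (Λ : Measure E) (P : Measure Ω) : Prop where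
  measurable : ∀ i, Measurable (A i)
  map_eq : ∀ B : Set E, MeasurableSet B → Λ B ≠ ∞ →
    P.map (fun ω => pointMeasure A ω B) =
      (poissonMeasure (Λ B).toNNReal).map (fun k : ℕ => (k : ℝ≥0∞))
  ae_eq_top : ∀ B : Set E, MeasurableSet B → Λ B = ∞ → ∀ᵐ ω ∂P, pointMeasure A ω B = ∞
  indep : ∀ (n : ℕ) (B : Fin n → Set E), (∀ j, MeasurableSet (B j)) →
    Pairwise (fun j k => Disjoint (B j) (B k)) →
    iIndepFun (fun j ω => pointMeasure A ω (B j)) P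

/-- The measure `a⁻² da` on `(0, ∞)`, regarded as a measure on `ℝ`. -/
def invSqIntensity : Measure ℝ :=
  (volume.restrict (Ioi 0)).withDensity fun a => ENNReal.ofReal (a ^ 2)⁻¹

/-- The law of a stochastic process `X = (X s)_{s ∈ S}` on the product space `S → ℝ`. -/
def processLaw {Ω S : Type*} [MeasurableSpace Ω] (X : S → Ω → ℝ) (P : Measure Ω) :
    Measure (S → ℝ) :=
  P.map fun ω s => X s ω

/-- Max-stability of a process: there are normalizing functions `a n > 0` and `b n` such that, for
every `n ≥ 1`, the pointwise maximum of `(X_i - b n) / a n` over `n` independent copies `X_i` of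
`X` has the law of `X`. The independent copies are realized as the coordinates of the `n`-fold
product of the law of `X`. -/
structure IsMaxStable {Ω S : Type*} [MeasurableSpace Ω] (X : S → Ω → ℝ) (P : Measure Ω) :
    Prop where
  measurable : ∀ s, Measurable (X s)
  exists_norming : ∃ a b : ℕ → S → ℝ, (∀ n s, 0 < a n s) ∧ ∀ n : ℕ, 1 ≤ n →
    processLaw X P =
      (Measure.pi fun _ : Fin n => processLaw X P).map
        (fun (y : Fin n → S → ℝ) (s : S) => ⨆ i, (y i s - b n s) / a n s)

/-- A simple max-stable process: max-stable with unit Fréchet margins. -/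
structure IsSimpleMaxStable {Ω S : Type*} [MeasurableSpace Ω] (X : S → Ω → ℝ)
    (P : Measure Ω) : Prop extends IsMaxStable X P where
  margins : ∀ s, IsFrechet 1 (X s) P

/-- The process `X s = U s / Γ(1 - 1/p) * ‖(A i * W i s)_i‖_p`. -/
def lpProcess {Ω S : Type*} (p : ℝ≥0∞) (U : S → Ω → ℝ) (A : ℕ → Ω → ℝ)
    (W : ℕ → S → Ω → ℝ) (s : S) (ω : Ω) : ℝ :=
  U s ω / Real.Gamma (1 - (p⁻¹).toReal) * (ellNorm p fun i => A i ω * W i s ω).toReal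

end LpMaxStable

end

/-!
The proof represents the finite-dimensional distributions of the process by the Laplace functional
of a marked Poisson process.

Write `negExp x = exp (-x)` on `[0, ∞]`, and let `frechetGauge p t` be `-log Φ_p (1 / t)`, that is
`t ^ p` for `p < ∞`, and `0` or `∞` according as `t ≤ 1` or `t > 1` for `p = ∞`. This gauge treats
all `p ∈ (1, ∞]` alike, because it turns the `ℓ^p` norm into a sum
(`frechetGauge_mul_ellNorm`). Given the points `A i` and the marks `W i`, independence of the
noise variables gives, with `g = Γ(1 - 1/p)`,
`P (X (s k) ≤ x k for all k | A, W) = negExp (∑ k, frechetGauge p (‖A ∘ W (s k)‖_p / (g * x k)))`.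
Applying the gauge identity twice, once over the index of the points and once over `k`, the exponent
becomes `∑ i, frechetGauge p (|A i| * V i)` with `V i = ‖(W i (s k) / (g * x k))_k‖_p`.

The expectation is then given by `IsPoissonProcess.lintegral_negExp_tsum_marked`. Its unmarked
version `IsPoissonProcess.lintegral_negExp_tsum` follows from the definition of a Poisson process
for simple functions and by monotone approximation in general. Finally
`∫ (1 - negExp (frechetGauge p (|a| * v))) a⁻² da = g * v`
(`lintegral_one_sub_negExp_frechetGauge`), so that the constant `g` cancels and the exponent is the
expected `ℓ^p` norm (`measure_lpProcess_le`).

For a single index `s`, the Laplace transform of the gauge of `c * ‖A ∘ W s‖_p` is `exp (-g * c)`;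
letting `c → 0` shows that the norm is almost surely finite (`ae_ellNorm_lt_top`). Max-stability
with norming functions `a n = n` and `b n = 0` follows since the exponent is homogeneous of degree `-1`
in `x` and finite-dimensional distribution functions determine the law (`isMaxStable_of_pow`).
-/

namespace LpMaxStable

/-! ### The exponential `exp (-x)` on `[0, ∞]` -/

/-- The function `x ↦ exp (-x)` from `[0, ∞]` to `[0, 1]`, with value `0` at `∞`. -/
noncomputable def negExp (x : ℝ≥0∞) : ℝ≥0∞ := (EReal.exp x)⁻¹

@[simp] lemma negExp_zero : negExp 0 = 1 := by simp [negExp]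

@[simp] lemma negExp_top : negExp ∞ = 0 := by simp [negExp]

lemma negExp_ofReal {x : ℝ} (hx : 0 ≤ x) :
    negExp (ENNReal.ofReal x) = ENNReal.ofReal (Real.exp (-x)) := by
  rw [negExp, EReal.coe_ennreal_ofReal, max_eq_left hx, EReal.exp_coe,
    ← ENNReal.ofReal_inv_of_pos (Real.exp_pos _), Real.exp_neg]

lemma negExp_of_ne_top {x : ℝ≥0∞} (hx : x ≠ ∞) :
    negExp x = ENNReal.ofReal (Real.exp (-x.toReal)) := by
  rw [← negExp_ofReal ENNReal.toReal_nonneg, ENNReal.ofReal_toReal hx]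

lemma negExp_add (x y : ℝ≥0∞) : negExp (x + y) = negExp x * negExp y := by
  rw [negExp, EReal.coe_ennreal_add, EReal.exp_add, negExp, negExp, ENNReal.mul_inv]
  · left
    rw [Ne, EReal.exp_eq_zero_iff]
    exact EReal.coe_ennreal_ne_bot x
  · right
    rw [Ne, EReal.exp_eq_zero_iff]
    exact EReal.coe_ennreal_ne_bot y

lemma negExp_sum {ι : Type*} (s : Finset ι) (f : ι → ℝ≥0∞) :
    negExp (∑ i ∈ s, f i) = ∏ i ∈ s, negExp (f i) := by
  classical
  induction s using Finset.induction_on with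
  | empty => simp
  | insert a s ha ih => rw [Finset.sum_insert ha, Finset.prod_insert ha, negExp_add, ih]

lemma continuous_negExp : Continuous negExp :=
  continuous_inv.comp (ENNReal.continuous_exp.comp continuous_coe_ennreal_ereal)

@[fun_prop] lemma measurable_negExp : Measurable negExp := continuous_negExp.measurable

lemma antitone_negExp : Antitone negExp := fun _ _ h =>
  ENNReal.inv_le_inv.2 (EReal.exp_monotone (EReal.coe_ennreal_le_coe_ennreal_iff.2 h))

lemma negExp_le_one (x : ℝ≥0∞) : negExp x ≤ 1 := by
  simpa using antitone_negExp (zero_le : (0 : ℝ≥0∞) ≤ x)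

/-- Every element of `[0, 1]` is a value of `negExp`, at a point depending measurably on it. -/
lemma exists_measurable_negExp_eq {E : Type*} [MeasurableSpace E] {h : E → ℝ≥0∞}
    (hm : Measurable h) (h1 : ∀ a, h a ≤ 1) :
    ∃ ψ : E → ℝ≥0∞, Measurable ψ ∧ ∀ a, negExp (ψ a) = h a := by
  refine ⟨fun a => (ENNReal.log (h a)⁻¹).toENNReal,
    (ENNReal.measurable_log.comp hm.inv).ereal_toENNReal, fun a => ?_⟩
  have h0 : (0 : EReal) ≤ ENNReal.log (h a)⁻¹ := by
    rw [ENNReal.zero_le_log_iff]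
    exact ENNReal.one_le_inv.2 (h1 a)
  rw [negExp, EReal.coe_toENNReal h0, ENNReal.exp_log, inv_inv]

/-! ### The gauge of a Fréchet law -/

/-- The function `t ↦ -log Φ_p (1 / t)`, where `Φ_p` is the `p`-Fréchet distribution function: it
is `t ^ p` for `p < ∞`, and `0` on `[0, 1]` and `∞` on `(1, ∞]` for `p = ∞`. -/
noncomputable def frechetGauge (p t : ℝ≥0∞) : ℝ≥0∞ :=
  if p = ∞ then (if t ≤ 1 then 0 else ∞) else t ^ p.toReal

lemma measurable_frechetGauge (p : ℝ≥0∞) : Measurable (frechetGauge p) := by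
  unfold frechetGauge
  split_ifs with h
  · exact Measurable.ite measurableSet_Iic measurable_const measurable_const
  · fun_prop

lemma frechetGauge_top {p : ℝ≥0∞} (hp : 1 < p) : frechetGauge p ∞ = ∞ := by
  unfold frechetGauge
  rcases eq_or_ne p ∞ with h | h
  · simp [h]
  · rw [if_neg h]
    exact ENNReal.top_rpow_of_pos (ENNReal.toReal_pos (zero_lt_one.trans hp).ne' h)

/-- The `ℓ^p` norm is the one for which the gauge turns scaled norms into sums. -/
lemma frechetGauge_mul_ellNorm {ι : Type*} {p : ℝ≥0∞} (hp : 1 < p) (c : ℝ≥0∞) (x : ι → ℝ) :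
    frechetGauge p (c * ellNorm p x) = ∑' i, frechetGauge p (c * ‖x i‖ₑ) := by
  unfold frechetGauge ellNorm
  split_ifs with h h'
  · rw [ENNReal.mul_iSup, iSup_le_iff] at h'
    simp [h']
  · rw [ENNReal.mul_iSup, iSup_le_iff] at h'
    push Not at h'
    obtain ⟨i, hi⟩ := h'
    symm
    refine ENNReal.tsum_eq_top_of_eq_top ⟨i, ?_⟩
    rw [if_neg hi.not_ge]
  · have hp0 : 0 < p.toReal := ENNReal.toReal_pos (zero_lt_one.trans hp).ne' h
    simp_rw [ENNReal.mul_rpow_of_nonneg _ _ hp0.le]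
    rw [ENNReal.tsum_mul_left, ← ENNReal.rpow_mul, one_div_mul_cancel hp0.ne', ENNReal.rpow_one]

/-- A scaled Fréchet variable, with the distribution function expressed by the gauge. -/
lemma IsFrechet.measure_mul_le {Ω : Type*} [MeasurableSpace Ω] {P : Measure Ω}
    [IsProbabilityMeasure P] {p : ℝ≥0∞} (hp : 1 < p) {Y : Ω → ℝ} (hY : IsFrechet p Y P)
    {g x : ℝ} (hg : 0 < g) (hx : 0 < x) {N : ℝ≥0∞} (hN : N ≠ ∞) :
    P {ω | Y ω / g * N.toReal ≤ x} =
      negExp (frechetGauge p (ENNReal.ofReal (g * x)⁻¹ * N)) := by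
  have hgx : 0 < g * x := mul_pos hg hx
  rcases eq_or_ne N 0 with rfl | hN0
  · have : frechetGauge p 0 = 0 := by
      unfold frechetGauge
      split_ifs with h h'
      · rfl
      · simp at h'
      · exact ENNReal.zero_rpow_of_pos (ENNReal.toReal_pos (zero_lt_one.trans hp).ne' h)
    simp [hx.le, this]
  have hr : 0 < N.toReal := ENNReal.toReal_pos hN0 hN
  have hset : {ω | Y ω / g * N.toReal ≤ x} = {ω | Y ω ≤ g * x / N.toReal} := by
    ext ω
    simp only [mem_ofPred_eq]
    rw [le_div_iff₀ hr, div_mul_eq_mul_div, div_le_iff₀ hg, mul_comm x g]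
  have hNr : ENNReal.ofReal (g * x)⁻¹ * N = ENNReal.ofReal (N.toReal / (g * x)) := by
    conv_lhs => rw [← ENNReal.ofReal_toReal hN]
    rw [← ENNReal.ofReal_mul (by positivity), div_eq_inv_mul]
  have hmeas := hY.cdf_eq (g * x / N.toReal)
  rw [hset, ← ofReal_measureReal, hmeas, hNr]
  unfold frechetCDF frechetGauge
  split_ifs with h h'
  · rw [ENNReal.ofReal_le_one, div_le_one hgx] at h'
    have : g * x / N.toReal ∈ Ici (1 : ℝ) := (one_le_div hr).2 h'
    simp [indicator_of_mem this]
  · rw [ENNReal.ofReal_le_one, div_le_one hgx] at h'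
    have : g * x / N.toReal ∉ Ici (1 : ℝ) := fun h => h' ((one_le_div hr).1 h)
    simp [indicator_of_notMem this]
  · have hq : 0 < g * x / N.toReal := by positivity
    have hp0 : 0 < p.toReal := ENNReal.toReal_pos (zero_lt_one.trans hp).ne' h
    rw [indicator_of_mem (mem_Ioi.2 hq), ENNReal.ofReal_rpow_of_pos (by positivity),
      negExp_ofReal (by positivity), Real.rpow_neg hq.le, ← Real.inv_rpow hq.le, inv_div]

/-! ### The intensity `a⁻² da` -/

lemma invSqIntensity_Ioi {b : ℝ} (hb : 0 < b) :
    invSqIntensity (Ioi b) = ENNReal.ofReal b⁻¹ := by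
  have hsub : Ioi b ∩ Ioi 0 = Ioi b := inter_eq_left.2 (Ioi_subset_Ioi hb.le)
  have hcongr : EqOn (fun a : ℝ => (a ^ 2)⁻¹) (fun a : ℝ => a ^ (-2 : ℝ)) (Ioi b) := by
    intro a ha
    simp only
    rw [Real.rpow_neg (hb.trans ha).le]
    norm_cast
  rw [invSqIntensity, withDensity_apply _ measurableSet_Ioi,
    Measure.restrict_restrict measurableSet_Ioi, hsub, ← ofReal_integral_eq_lintegral_ofReal]
  · rw [setIntegral_congr_fun measurableSet_Ioi hcongr,
      integral_Ioi_rpow_of_lt (by norm_num) hb]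
    norm_num
    rw [Real.rpow_neg_one]
  · exact (integrableOn_Ioi_rpow_of_lt (by norm_num) hb).congr_fun hcongr.symm measurableSet_Ioi
  · exact Filter.Eventually.of_forall fun a => by positivity

instance : SFinite invSqIntensity := by
  unfold invSqIntensity; infer_instance

lemma ae_invSqIntensity_pos : ∀ᵐ a ∂invSqIntensity, 0 < a := by
  unfold invSqIntensity
  exact (withDensity_absolutelyContinuous _ _).ae_le (ae_restrict_mem measurableSet_Ioi)

/-- The intensity has the tail `Λ {a | a > b} = 1 / b`, in a form allowing zero and infinity. -/
lemma invSqIntensity_lt_mul {u v : ℝ≥0∞} (hu0 : u ≠ 0) (hu : u ≠ ∞) (hv : v ≠ ∞) :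
    invSqIntensity {a | u < ‖a‖ₑ * v} = v / u := by
  rcases eq_or_ne v 0 with rfl | hv0
  · simp
  have hb : 0 < u.toReal / v.toReal :=
    div_pos (ENNReal.toReal_pos hu0 hu) (ENNReal.toReal_pos hv0 hv)
  have h : {a | u < ‖a‖ₑ * v} =ᵐ[invSqIntensity] Ioi (u.toReal / v.toReal) := by
    filter_upwards [ae_invSqIntensity_pos] with a ha
    apply propext
    change u < ‖a‖ₑ * v ↔ u.toReal / v.toReal < a
    rw [div_lt_iff₀ (ENNReal.toReal_pos hv0 hv), Real.enorm_of_nonneg ha.le,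
      ← ENNReal.toReal_lt_toReal hu (ENNReal.mul_ne_top ENNReal.ofReal_ne_top hv),
      ENNReal.toReal_mul, ENNReal.toReal_ofReal ha.le]
  rw [measure_congr h, invSqIntensity_Ioi hb, inv_div,
    ENNReal.ofReal_div_of_pos (ENNReal.toReal_pos hu0 hu), ENNReal.ofReal_toReal hu,
    ENNReal.ofReal_toReal hv]

/-- `1 - exp (-t)` is the mass that the unit exponential law gives to `(0, t)`. -/
lemma one_sub_negExp_eq_lintegral {t : ℝ≥0∞} (ht : t ≠ ∞) :
    1 - negExp t = ∫⁻ z in Ioi (0 : ℝ), ENNReal.ofReal (Real.exp (-z)) *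
      {z : ℝ | ENNReal.ofReal z < t}.indicator 1 z := by
  have hsplit : ∀ z : ℝ, ENNReal.ofReal (Real.exp (-z)) *
      {z : ℝ | ENNReal.ofReal z < t}.indicator (1 : ℝ → ℝ≥0∞) z =
      {z : ℝ | ENNReal.ofReal z < t}.indicator (fun z => ENNReal.ofReal (Real.exp (-z))) z := by
    intro z
    by_cases hz : z ∈ {z : ℝ | ENNReal.ofReal z < t} <;> simp [hz]
  have hm : MeasurableSet {z : ℝ | ENNReal.ofReal z < t} :=
    measurableSet_lt (by fun_prop) measurable_const
  have hset : {z : ℝ | ENNReal.ofReal z < t} ∩ Ioi 0 = Ioo 0 t.toReal := by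
    ext z
    simp only [mem_inter_iff, mem_ofPred_eq, mem_Ioi, mem_Ioo]
    rw [and_comm]
    refine and_congr_right fun hz => ?_
    rw [ENNReal.ofReal_lt_iff_lt_toReal hz.le ht]
  simp_rw [hsplit]
  rw [lintegral_indicator hm, Measure.restrict_restrict hm, hset,
    setLIntegral_congr Ioo_ae_eq_Ioc, ← ofReal_integral_eq_lintegral_ofReal]
  · rw [← intervalIntegral.integral_of_le ENNReal.toReal_nonneg, negExp_of_ne_top ht,
      ← ENNReal.ofReal_one, ← ENNReal.ofReal_sub _ (Real.exp_nonneg _)]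
    congr 1
    simp [intervalIntegral.integral_comp_neg (fun x => Real.exp x)]
  · exact (Continuous.integrableOn_Icc (by fun_prop)).mono_set Ioc_subset_Icc_self
  · exact Filter.Eventually.of_forall fun a => Real.exp_nonneg _

/-- The gauge integrates against the intensity to `Γ(1 - 1/p)`. For `p < ∞` the integrand is a tail
probability of an exponential variable, and Tonelli reduces the integral to the tail of the
intensity and Euler's integral. -/
lemma lintegral_one_sub_negExp_frechetGauge {p : ℝ≥0∞} (hp : 1 < p) {v : ℝ≥0∞} (hv : v ≠ ∞) :
    ∫⁻ a, (1 - negExp (frechetGauge p (‖a‖ₑ * v))) ∂invSqIntensity =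
      ENNReal.ofReal (Real.Gamma (1 - p⁻¹.toReal)) * v := by
  rcases eq_or_ne p ∞ with rfl | hptop
  · have : ∀ a : ℝ, 1 - negExp (frechetGauge ∞ (‖a‖ₑ * v)) =
        {a : ℝ | 1 < ‖a‖ₑ * v}.indicator 1 a := by
      intro a
      by_cases h : ‖a‖ₑ * v ≤ 1
      · simp [frechetGauge, h]
      · simp [frechetGauge, h, not_le.1 h]
    simp_rw [this]
    rw [lintegral_indicator_one (measurableSet_lt measurable_const (by fun_prop)),
      invSqIntensity_lt_mul one_ne_zero ENNReal.one_ne_top hv]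
    simp
  have hp0 : 0 < p.toReal := ENNReal.toReal_pos (zero_lt_one.trans hp).ne' hptop
  have hp1 : 1 < p.toReal := by
    rw [← ENNReal.toReal_one]
    exact (ENNReal.toReal_lt_toReal ENNReal.one_ne_top hptop).2 hp
  have hq : 0 < 1 - p.toReal⁻¹ := sub_pos.2 (inv_lt_one_of_one_lt₀ hp1)
  have h1 : ∀ a : ℝ, 1 - negExp (frechetGauge p (‖a‖ₑ * v)) =
      ∫⁻ z in Ioi (0 : ℝ), ENNReal.ofReal (Real.exp (-z)) *
        {z : ℝ | ENNReal.ofReal z < (‖a‖ₑ * v) ^ p.toReal}.indicator 1 z := by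
    intro a
    rw [frechetGauge, if_neg hptop, one_sub_negExp_eq_lintegral]
    exact ENNReal.rpow_ne_top_of_nonneg hp0.le (ENNReal.mul_ne_top enorm_ne_top hv)
  have hmeas : MeasurableSet {q : ℝ × ℝ | ENNReal.ofReal q.2 < (‖q.1‖ₑ * v) ^ p.toReal} :=
    measurableSet_lt (by fun_prop) (by fun_prop)
  simp_rw [h1]
  rw [lintegral_lintegral_swap]
  · -- For fixed `z` the integral over `a` is `exp (-z) * z ^ (-1/p) * v`, by the tail formula.
    have h2 : ∀ z ∈ Ioi (0 : ℝ), ∫⁻ a, ENNReal.ofReal (Real.exp (-z)) *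
        {z : ℝ | ENNReal.ofReal z < (‖a‖ₑ * v) ^ p.toReal}.indicator 1 z ∂invSqIntensity =
        ENNReal.ofReal (Real.exp (-z) * z ^ ((1 - p.toReal⁻¹) - 1)) * v := by
      intro z hz
      have hz' : (0 : ℝ) < z := hz
      have hind : ∀ a : ℝ,
          {z : ℝ | ENNReal.ofReal z < (‖a‖ₑ * v) ^ p.toReal}.indicator (1 : ℝ → ℝ≥0∞) z =
          {a : ℝ | ENNReal.ofReal (z ^ p.toReal⁻¹) < ‖a‖ₑ * v}.indicator 1 a := by
        intro a
        have : ENNReal.ofReal z < (‖a‖ₑ * v) ^ p.toReal ↔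
            ENNReal.ofReal (z ^ p.toReal⁻¹) < ‖a‖ₑ * v := by
          rw [← ENNReal.rpow_inv_lt_iff hp0, ENNReal.ofReal_rpow_of_pos hz']
        by_cases h : ENNReal.ofReal (z ^ p.toReal⁻¹) < ‖a‖ₑ * v <;> simp [this, h]
      simp_rw [hind]
      have hzp : 0 < z ^ p.toReal⁻¹ := Real.rpow_pos_of_pos hz' _
      rw [lintegral_const_mul' _ _ ENNReal.ofReal_ne_top,
        lintegral_indicator_one (measurableSet_lt measurable_const (by fun_prop)),
        invSqIntensity_lt_mul (by simpa using hzp) ENNReal.ofReal_ne_top hv,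
        ENNReal.ofReal_mul (Real.exp_nonneg _), mul_assoc, sub_sub_cancel_left,
        Real.rpow_neg hz'.le, ENNReal.ofReal_inv_of_pos hzp, div_eq_mul_inv, mul_comm v]
    rw [setLIntegral_congr_fun measurableSet_Ioi h2, lintegral_mul_const' _ _ hv,
      ← ofReal_integral_eq_lintegral_ofReal (Real.GammaIntegral_convergent hq)]
    · rw [Real.Gamma_eq_integral (by simpa using hq), ENNReal.toReal_inv]
    · filter_upwards [ae_restrict_mem measurableSet_Ioi] with z hz
      exact mul_nonneg (Real.exp_nonneg _) (Real.rpow_nonneg (le_of_lt hz) _)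
  · refine Measurable.aemeasurable ?_
    have : (fun q : ℝ × ℝ => {z : ℝ | ENNReal.ofReal z < (‖q.1‖ₑ * v) ^ p.toReal}.indicator
        (1 : ℝ → ℝ≥0∞) q.2) = {q : ℝ × ℝ | ENNReal.ofReal q.2 <
          (‖q.1‖ₑ * v) ^ p.toReal}.indicator 1 := rfl
    refine Measurable.mul (by fun_prop) ?_
    rw [this]
    exact measurable_one.indicator hmeas

/-! ### The Laplace functional of a Poisson process -/

lemma lintegral_negExp_poissonMeasure (r : ℝ≥0) {c : ℝ≥0∞} (hc : c ≠ ∞) :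
    ∫⁻ k : ℕ, negExp (c * k) ∂(poissonMeasure r) = negExp ((1 - negExp c) * r) := by
  have hs : ∀ k : ℕ, negExp (c * k) * poissonMeasure r {k} =
      ENNReal.ofReal (Real.exp (-r) * ((r * Real.exp (-c.toReal)) ^ k / k.factorial)) := by
    intro k
    rw [poissonMeasure_singleton, negExp_of_ne_top (ENNReal.mul_ne_top hc (by simp)),
      ← ENNReal.ofReal_mul (Real.exp_nonneg _)]
    congr 1
    have hk : Real.exp (-(c * k).toReal) = Real.exp (-c.toReal) ^ k := by
      rw [← Real.exp_nat_mul, ENNReal.toReal_mul, ENNReal.toReal_natCast]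
      ring_nf
    rw [hk, mul_pow]
    ring
  have hsum : HasSum (fun k : ℕ => Real.exp (-r) * ((r * Real.exp (-c.toReal)) ^ k / k.factorial))
      (Real.exp (-r) * Real.exp (r * Real.exp (-c.toReal))) := by
    have h := NormedSpace.expSeries_div_hasSum_exp (r * Real.exp (-c.toReal) : ℝ)
    rw [← Real.exp_eq_exp_ℝ] at h
    exact h.mul_left _
  rw [lintegral_countable']
  simp_rw [hs]
  rw [← ENNReal.ofReal_tsum_of_nonneg (fun k => by positivity) hsum.summable, hsum.tsum_eq,
    ← Real.exp_add]
  have h1 : (1 - negExp c) * r = ENNReal.ofReal ((1 - Real.exp (-c.toReal)) * r) := by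
    rw [negExp_of_ne_top hc, ENNReal.ofReal_mul (by simp),
      ENNReal.ofReal_sub _ (Real.exp_nonneg _), ENNReal.ofReal_one, ENNReal.ofReal_coe_nnreal]
  rw [h1, negExp_ofReal (mul_nonneg (by simp) r.coe_nonneg)]
  congr 2
  ring

lemma lintegral_pointMeasure {Ω E : Type*} [MeasurableSpace E] (A : ℕ → Ω → E) (ω : Ω)
    {f : E → ℝ≥0∞} (hf : Measurable f) : ∫⁻ a, f a ∂(pointMeasure A ω) = ∑' i, f (A i ω) := by
  rw [pointMeasure, lintegral_sum_measure]
  exact tsum_congr fun i => lintegral_dirac' _ hf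

section Poisson

variable {Ω E : Type*} [MeasurableSpace Ω] [MeasurableSpace E] {P : Measure Ω}
  {A : ℕ → Ω → E} {Λ : Measure E}

lemma IsPoissonProcess.measurable_count (hA : IsPoissonProcess A Λ P) {B : Set E}
    (hB : MeasurableSet B) : Measurable fun ω => pointMeasure A ω B := by
  have : (fun ω => pointMeasure A ω B) = fun ω => ∑' i, B.indicator (1 : E → ℝ≥0∞) (A i ω) := by
    funext ω
    rw [← lintegral_pointMeasure A ω (measurable_one.indicator hB), lintegral_indicator_one hB]
  rw [this]
  exact Measurable.tsum fun i => (measurable_one.indicator hB).comp (hA.measurable i)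

lemma IsPoissonProcess.lintegral_negExp_count [IsProbabilityMeasure P]
    (hA : IsPoissonProcess A Λ P) {B : Set E} (hB : MeasurableSet B) {c : ℝ≥0∞} (hc : c ≠ ∞) :
    ∫⁻ ω, negExp (c * pointMeasure A ω B) ∂P = negExp ((1 - negExp c) * Λ B) := by
  by_cases hΛ : Λ B = ∞
  · rcases eq_or_ne c 0 with rfl | hc0
    · simp
    · -- Both sides vanish: `B` almost surely contains infinitely many points.
      have h1 : 1 - negExp c ≠ 0 := by
        rw [negExp_of_ne_top hc, Ne, tsub_eq_zero_iff_le, not_le, ENNReal.ofReal_lt_one]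
        simpa using ENNReal.toReal_pos hc0 hc
      have h2 : (fun ω => negExp (c * pointMeasure A ω B)) =ᵐ[P] 0 := by
        filter_upwards [hA.ae_eq_top B hB hΛ] with ω hω
        simp [hω, ENNReal.mul_top hc0]
      rw [lintegral_congr_ae h2, hΛ, ENNReal.mul_top h1]
      simp
  · have h := lintegral_map (μ := P) (f := fun x : ℝ≥0∞ => negExp (c * x)) (by fun_prop)
      (hA.measurable_count hB)
    rw [← h, hA.map_eq B hB hΛ, lintegral_map (by fun_prop) (measurable_of_countable _),
      lintegral_negExp_poissonMeasure _ hc, ENNReal.coe_toNNReal hΛ]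

/-- The Laplace functional at a simple function. -/
lemma IsPoissonProcess.lintegral_negExp_simpleFunc [IsProbabilityMeasure P]
    (hA : IsPoissonProcess A Λ P) (f : SimpleFunc E ℝ≥0∞) (hf : ∀ a, f a ≠ ∞) :
    ∫⁻ ω, negExp (∫⁻ a, f a ∂(pointMeasure A ω)) ∂P =
      negExp (∫⁻ a, (1 - negExp (f a)) ∂Λ) := by
  let e := f.range.equivFin
  -- The level sets, indexed by the values of `f`, are disjoint, so their counts are independent.
  have hind : iIndepFun (fun (x : f.range) ω => pointMeasure A ω (f ⁻¹' {x.1})) P := by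
    have h := hA.indep f.range.card (fun j => f ⁻¹' {(e.symm j).1})
      (fun j => f.measurableSet_fiber _) (fun j k hjk => by
        refine Disjoint.preimage _ (disjoint_singleton.2 fun h => hjk ?_)
        exact e.symm.injective (Subtype.ext h))
    simpa using h.precomp e.injective
  have hL : ∀ ω, negExp (∫⁻ a, f a ∂(pointMeasure A ω)) =
      ∏ x : f.range, negExp (x.1 * pointMeasure A ω (f ⁻¹' {x.1})) := by
    intro ω
    rw [SimpleFunc.lintegral_eq_lintegral, SimpleFunc.lintegral, negExp_sum,
      ← Finset.prod_coe_sort]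
  have hR : ∫⁻ a, (1 - negExp (f a)) ∂Λ = ∑ x ∈ f.range, (1 - negExp x) * Λ (f ⁻¹' {x}) := by
    rw [← SimpleFunc.map_lintegral (fun x => 1 - negExp x) f, ← SimpleFunc.lintegral_eq_lintegral]
    rfl
  simp_rw [hL]
  rw [hR, negExp_sum, ← Finset.prod_coe_sort]
  refine (lintegral_prod_eq_prod_lintegral_of_indepFun Finset.univ _
    (hind.comp (fun (x : f.range) y => negExp (x.1 * y)) fun x => by fun_prop)
    (fun x => by
      have := hA.measurable_count (f.measurableSet_fiber x.1)
      simp only [Function.comp_def]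
      fun_prop)).trans ?_
  refine Finset.prod_congr rfl fun x _ => ?_
  obtain ⟨a, ha⟩ := SimpleFunc.mem_range.1 x.2
  exact hA.lintegral_negExp_count (f.measurableSet_fiber x.1) (ha ▸ hf a)

/-- The Laplace functional of a Poisson process. -/
theorem IsPoissonProcess.lintegral_negExp_tsum [IsProbabilityMeasure P]
    (hA : IsPoissonProcess A Λ P) {f : E → ℝ≥0∞} (hf : Measurable f) :
    ∫⁻ ω, negExp (∑' i, f (A i ω)) ∂P = negExp (∫⁻ a, (1 - negExp (f a)) ∂Λ) := by
  have hmono : ∀ a, Monotone fun n => SimpleFunc.eapprox f n a := fun a _ _ h =>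
    SimpleFunc.monotone_eapprox f h a
  have hm : ∀ i, Measurable (A i) := hA.measurable
  have hR : Filter.Tendsto
      (fun n => negExp (∫⁻ a, (1 - negExp (SimpleFunc.eapprox f n a)) ∂Λ)) Filter.atTop
      (nhds (negExp (∫⁻ a, (1 - negExp (f a)) ∂Λ))) := by
    refine (continuous_negExp.tendsto _).comp ?_
    refine lintegral_tendsto_of_tendsto_of_monotone (fun n => Measurable.aemeasurable ?_) ?_ ?_
    · have := (SimpleFunc.eapprox f n).measurable
      fun_prop
    · exact Filter.Eventually.of_forall fun a _ _ h =>
        tsub_le_tsub_left (antitone_negExp (hmono a h)) 1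
    · refine Filter.Eventually.of_forall fun a => ?_
      exact ENNReal.Tendsto.sub tendsto_const_nhds
        ((continuous_negExp.tendsto _).comp (SimpleFunc.tendsto_eapprox hf a))
        (Or.inl ENNReal.one_ne_top)
  have hL : Filter.Tendsto
      (fun n => ∫⁻ ω, negExp (∫⁻ a, SimpleFunc.eapprox f n a ∂(pointMeasure A ω)) ∂P) Filter.atTop
      (nhds (∫⁻ ω, negExp (∑' i, f (A i ω)) ∂P)) := by
    refine tendsto_lintegral_of_dominated_convergence 1 (fun n => ?_) (fun n => ?_) ?_ ?_
    · simp_rw [lintegral_pointMeasure A _ (SimpleFunc.eapprox f n).measurable]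
      exact measurable_negExp.comp (Measurable.tsum fun i =>
        (SimpleFunc.eapprox f n).measurable.comp (hm i))
    · exact Filter.Eventually.of_forall fun ω => negExp_le_one _
    · simp
    · refine Filter.Eventually.of_forall fun ω => (continuous_negExp.tendsto _).comp ?_
      rw [← lintegral_pointMeasure A ω hf]
      exact lintegral_tendsto_of_tendsto_of_monotone
        (fun n => (SimpleFunc.eapprox f n).measurable.aemeasurable)
        (Filter.Eventually.of_forall hmono)
        (Filter.Eventually.of_forall (SimpleFunc.tendsto_eapprox hf))
  refine tendsto_nhds_unique hL ?_
  simp_rw [hA.lintegral_negExp_simpleFunc _ fun a => (SimpleFunc.eapprox_lt_top f _ a).ne]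
  exact hR

/-- Independent variables `M i`: the Laplace transform of `∑ i, φ i (M i)` is an infinite
product. -/
lemma lintegral_negExp_tsum_of_iIndepFun [IsProbabilityMeasure P] {F : Type*} [MeasurableSpace F]
    {M : ℕ → Ω → F} (hM : ∀ i, Measurable (M i)) (hMi : iIndepFun M P)
    {φ : ℕ → F → ℝ≥0∞} (hφ : ∀ i, Measurable (φ i)) {ψ : ℕ → ℝ≥0∞}
    (hψ : ∀ i, negExp (ψ i) = ∫⁻ ω, negExp (φ i (M i ω)) ∂P) :
    ∫⁻ ω, negExp (∑' i, φ i (M i ω)) ∂P = negExp (∑' i, ψ i) := by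
  have hL : Filter.Tendsto
      (fun n => ∫⁻ ω, negExp (∑ i ∈ Finset.range n, φ i (M i ω)) ∂P) Filter.atTop
      (nhds (∫⁻ ω, negExp (∑' i, φ i (M i ω)) ∂P)) := by
    refine tendsto_lintegral_of_dominated_convergence 1 (fun n => ?_) (fun n => ?_) ?_ ?_
    · fun_prop
    · exact Filter.Eventually.of_forall fun ω => negExp_le_one _
    · simp
    · exact Filter.Eventually.of_forall fun ω => (continuous_negExp.tendsto _).comp
        ENNReal.summable.hasSum.tendsto_sum_nat
  have hR : Filter.Tendsto (fun n => negExp (∑ i ∈ Finset.range n, ψ i)) Filter.atTop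
      (nhds (negExp (∑' i, ψ i))) :=
    (continuous_negExp.tendsto _).comp ENNReal.summable.hasSum.tendsto_sum_nat
  refine tendsto_nhds_unique hL ?_
  convert hR using 2 with n
  simp_rw [negExp_sum]
  refine (lintegral_prod_eq_prod_lintegral_of_indepFun (Finset.range n) _
    (hMi.comp (fun i m => negExp (φ i m)) fun i => by fun_prop)
    (fun i => by simp only [Function.comp_def]; fun_prop)).trans ?_
  exact Finset.prod_congr rfl fun i _ => (hψ i).symm

/-- The Laplace functional of a Poisson process with independent, identically distributed marks.
Given the points, the marks contribute the factors `∫ exp (-φ (A i, w)) ν(dw)`, so this is the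
Laplace functional of the unmarked process at `-log` of that integral. -/
theorem IsPoissonProcess.lintegral_negExp_tsum_marked [IsProbabilityMeasure P]
    (hA : IsPoissonProcess A Λ P) {F : Type*} [MeasurableSpace F] {M : ℕ → Ω → F}
    (hM : ∀ i, Measurable (M i)) (hMi : iIndepFun M P) {ν : Measure F} [IsProbabilityMeasure ν]
    (hν : ∀ i, P.map (M i) = ν) (hAM : IndepFun (fun ω i => A i ω) (fun ω i => M i ω) P)
    {φ : E → F → ℝ≥0∞} (hφ : Measurable (Function.uncurry φ)) :
    ∫⁻ ω, negExp (∑' i, φ (A i ω) (M i ω)) ∂P =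
      negExp (∫⁻ a, ∫⁻ w, (1 - negExp (φ a w)) ∂ν ∂Λ) := by
  have hmA : Measurable fun ω i => A i ω := measurable_pi_lambda _ hA.measurable
  have hmM : Measurable fun ω i => M i ω := measurable_pi_lambda _ hM
  have hφa : ∀ a, Measurable (φ a) := fun a => hφ.comp measurable_prodMk_left
  have hh : Measurable fun a => ∫⁻ w, negExp (φ a w) ∂ν :=
    (measurable_negExp.comp hφ).lintegral_prod_right'
  have hh1 : ∀ a, ∫⁻ w, negExp (φ a w) ∂ν ≤ 1 := fun a =>
    (lintegral_mono fun w => negExp_le_one _).trans (by simp)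
  -- `ψ a = -log ∫ exp (-φ (a, w)) ν(dw)`
  obtain ⟨ψ, hψm, hψ⟩ := exists_measurable_negExp_eq hh hh1
  have hG : Measurable fun q : (ℕ → E) × (ℕ → F) => negExp (∑' i, φ (q.1 i) (q.2 i)) := by
    refine measurable_negExp.comp (Measurable.tsum fun i => ?_)
    exact hφ.comp (by fun_prop : Measurable fun q : (ℕ → E) × (ℕ → F) => (q.1 i, q.2 i))
  have hprod := (indepFun_iff_map_prod_eq_prod_map_map hmA.aemeasurable hmM.aemeasurable).1 hAM
  have := Measure.isProbabilityMeasure_map (μ := P) hmM.aemeasurable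
  calc ∫⁻ ω, negExp (∑' i, φ (A i ω) (M i ω)) ∂P
      = ∫⁻ q, negExp (∑' i, φ (q.1 i) (q.2 i))
          ∂(P.map fun ω => ((fun i => A i ω), (fun i => M i ω))) :=
        (lintegral_map hG (hmA.prodMk hmM)).symm
    _ = ∫⁻ ω, ∫⁻ ω', negExp (∑' i, φ (A i ω) (M i ω')) ∂P ∂P := by
        rw [hprod, lintegral_prod _ hG.aemeasurable, lintegral_map hG.lintegral_prod_right' hmA]
        refine lintegral_congr fun ω => ?_
        exact lintegral_map (hG.comp measurable_prodMk_left) hmM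
    _ = ∫⁻ ω, negExp (∑' i, ψ (A i ω)) ∂P := by
        refine lintegral_congr fun ω => ?_
        refine lintegral_negExp_tsum_of_iIndepFun hM hMi (fun i => hφa _) fun i => ?_
        rw [hψ, ← hν i, lintegral_map (by fun_prop) (hM i)]
    _ = negExp (∫⁻ a, ∫⁻ w, (1 - negExp (φ a w)) ∂ν ∂Λ) := by
        rw [hA.lintegral_negExp_tsum hψm]
        congr 1
        refine lintegral_congr fun a => ?_
        rw [hψ, lintegral_sub (by fun_prop)
          ((hh1 a).trans_lt ENNReal.one_lt_top).ne (Filter.Eventually.of_forall fun w =>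
            negExp_le_one _)]
        simp

end Poisson

/-! ### The `ℓ^p` norm -/

lemma ellNorm_const_mul {ι : Type*} {p : ℝ≥0∞} (hp : 1 < p) (c : ℝ) (x : ι → ℝ) :
    ellNorm p (fun i => c * x i) = ‖c‖ₑ * ellNorm p x := by
  unfold ellNorm
  simp_rw [enorm_mul]
  split_ifs with h
  · rw [ENNReal.mul_iSup]
  · have hp0 : 0 < p.toReal := ENNReal.toReal_pos (zero_lt_one.trans hp).ne' h
    simp_rw [ENNReal.mul_rpow_of_nonneg _ _ hp0.le]
    rw [ENNReal.tsum_mul_left, ENNReal.mul_rpow_of_nonneg _ _ (by positivity), ← ENNReal.rpow_mul,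
      mul_one_div_cancel hp0.ne', ENNReal.rpow_one]

lemma ellNorm_unique {ι : Type*} [Unique ι] {p : ℝ≥0∞} (hp : 1 < p) (x : ι → ℝ) :
    ellNorm p x = ‖x default‖ₑ := by
  unfold ellNorm
  split_ifs with h
  · exact iSup_unique (f := fun i => ‖x i‖ₑ)
  · have hp0 : 0 < p.toReal := ENNReal.toReal_pos (zero_lt_one.trans hp).ne' h
    rw [tsum_fintype, Fintype.sum_unique, ← ENNReal.rpow_mul, mul_one_div_cancel hp0.ne',
      ENNReal.rpow_one]

lemma ellNorm_le_sum {ι : Type*} [Fintype ι] {p : ℝ≥0∞} (hp : 1 < p) (x : ι → ℝ) :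
    ellNorm p x ≤ ∑ i, ‖x i‖ₑ := by
  classical
  unfold ellNorm
  split_ifs with h
  · exact iSup_le fun i => Finset.single_le_sum (f := fun i => ‖x i‖ₑ) (fun _ _ => zero_le)
      (Finset.mem_univ i)
  · have hp1 : 1 < p.toReal := by
      rw [← ENNReal.toReal_one]
      exact (ENNReal.toReal_lt_toReal ENNReal.one_ne_top h).2 hp
    rw [one_div, ENNReal.rpow_inv_le_iff (zero_lt_one.trans hp1), tsum_fintype]
    induction (Finset.univ : Finset ι) using Finset.induction_on with
    | empty => simp
    | insert a s ha ih =>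
      rw [Finset.sum_insert ha, Finset.sum_insert ha]
      exact (add_le_add_right ih _).trans (ENNReal.add_rpow_le_rpow_add _ _ hp1.le)

lemma ellNorm_ne_top {ι : Type*} [Fintype ι] {p : ℝ≥0∞} (hp : 1 < p) (x : ι → ℝ) :
    ellNorm p x ≠ ∞ :=
  ((ellNorm_le_sum hp x).trans_lt (ENNReal.sum_lt_top.2 fun _ _ => enorm_lt_top)).ne

lemma measurable_ellNorm {ι α : Type*} [Countable ι] [MeasurableSpace α] (p : ℝ≥0∞)
    {f : ι → α → ℝ} (hf : ∀ i, Measurable (f i)) :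
    Measurable fun a => ellNorm p fun i => f i a := by
  unfold ellNorm
  split_ifs with h
  · exact Measurable.iSup fun i => (hf i).enorm
  · exact (Measurable.tsum fun i => (hf i).enorm.pow_const _).pow_const _

/-! ### Max-stability from finite-dimensional distributions -/

/-- A finite measure on `S → ℝ` is determined by its finite-dimensional distribution functions. -/
lemma ext_of_finite_dim_cdf {S : Type*} {μ ν : Measure (S → ℝ)} [IsFiniteMeasure μ]
    (h : ∀ (t : Finset S) (x : S → ℝ),
      μ {y | ∀ s ∈ t, y s ≤ x s} = ν {y | ∀ s ∈ t, y s ≤ x s}) : μ = ν := by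
  classical
  let π : S → Set (Set (S → ℝ)) := fun s => {B | ∃ x : ℝ, {y | y s ≤ x} = B}
  have hπ : ∀ s, IsPiSystem (π s) := by
    rintro s _ ⟨x, rfl⟩ _ ⟨x', rfl⟩ -
    exact ⟨min x x', by ext y; simp⟩
  refine ext_of_generate_finite (piiUnionInter π univ) (le_antisymm ?_ ?_)
    (isPiSystem_piiUnionInter π hπ univ) ?_ ?_
  · refine iSup_le fun s => ?_
    rw [BorelSpace.measurable_eq (α := ℝ), borel_eq_generateFrom_Iic,
      MeasurableSpace.comap_generateFrom]
    refine MeasurableSpace.generateFrom_mono ?_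
    rintro _ ⟨_, ⟨x, rfl⟩, rfl⟩
    exact subset_piiUnionInter (mem_univ s) ⟨x, rfl⟩
  · refine generateFrom_piiUnionInter_le π (fun s => MeasurableSpace.generateFrom_le ?_) univ
    rintro _ ⟨x, rfl⟩
    exact measurableSet_le (measurable_pi_apply s) measurable_const
  · rintro _ ⟨t, -, f, hf, rfl⟩
    choose! x hx using hf
    have : ⋂ s ∈ t, f s = {y | ∀ s ∈ t, y s ≤ x s} := by
      ext y
      simp only [mem_iInter, mem_ofPred_eq]
      refine forall₂_congr fun s hs => ?_
      rw [← hx s hs]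
      rfl
    rw [this, h]
  · simpa using h ∅ 0

/-- A criterion for max-stability with norming functions `a n = n` and `b n = 0`. -/
lemma isMaxStable_of_pow {Ω S : Type*} [MeasurableSpace Ω] {P : Measure Ω} [IsProbabilityMeasure P]
    {X : S → Ω → ℝ} (hX : ∀ s, Measurable (X s))
    (h : ∀ (n : ℕ), 1 ≤ n → ∀ (t : Finset S) (x : S → ℝ),
      P {ω | ∀ s ∈ t, X s ω ≤ n * x s} ^ n = P {ω | ∀ s ∈ t, X s ω ≤ x s}) :
    IsMaxStable X P := by
  have hXm : Measurable fun ω s => X s ω := measurable_pi_lambda _ hX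
  have : IsProbabilityMeasure (processLaw X P) := Measure.isProbabilityMeasure_map hXm.aemeasurable
  have hbox : ∀ (t : Finset S) (x : S → ℝ), MeasurableSet {y : S → ℝ | ∀ s ∈ t, y s ≤ x s} := by
    intro t x
    have : {y : S → ℝ | ∀ s ∈ t, y s ≤ x s} = ⋂ s ∈ t, {y | y s ≤ x s} := by ext; simp
    rw [this]
    exact t.measurableSet_biInter fun s _ =>
      measurableSet_le (measurable_pi_apply s) measurable_const
  have hlaw : ∀ (t : Finset S) (x : S → ℝ), processLaw X P {y | ∀ s ∈ t, y s ≤ x s} =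
      P {ω | ∀ s ∈ t, X s ω ≤ x s} := fun t x => Measure.map_apply hXm (hbox t x)
  -- The norming function must be positive at `n = 0` as well, hence `max n 1`.
  refine ⟨hX, fun n _ => max n 1, fun _ _ => 0, fun n s => by positivity, fun n hn => ?_⟩
  have hn0 : (0 : ℝ) < n := by exact_mod_cast hn
  have hmax : max (n : ℝ) 1 = n := max_eq_left (by exact_mod_cast hn)
  have : Nonempty (Fin n) := ⟨⟨0, hn⟩⟩
  have hm : Measurable fun (y : Fin n → S → ℝ) (s : S) => ⨆ i, (y i s - 0) / max (n : ℝ) 1 := by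
    refine measurable_pi_lambda _ fun s => Measurable.iSup fun i => ?_
    fun_prop
  refine ext_of_finite_dim_cdf fun t x => ?_
  rw [hlaw, Measure.map_apply hm (hbox t x), ← h n hn]
  have hset : (fun (y : Fin n → S → ℝ) (s : S) => ⨆ i, (y i s - 0) / max (n : ℝ) 1) ⁻¹'
      {y | ∀ s ∈ t, y s ≤ x s} = univ.pi fun _ => {y | ∀ s ∈ t, y s ≤ n * x s} := by
    ext y
    simp only [mem_preimage, mem_ofPred_eq, mem_univ_pi, hmax, sub_zero]
    rw [forall_comm]
    refine forall_congr' fun s => ?_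
    rw [forall_comm]
    refine forall_congr' fun hs => ?_
    -- `Fin n` is nonempty, so the supremum is not a junk value.
    rw [ciSup_le_iff (finite_range _).bddAbove]
    exact forall_congr' fun i => by rw [div_le_iff₀ hn0, mul_comm]
  rw [hset, Measure.pi_pi]
  simp_rw [hlaw]
  simp

/-! ### The finite-dimensional distributions -/

/-- For independent `U` and `V`, probabilities are computed by freezing `V`. -/
lemma measure_eq_lintegral_of_indepFun {Ω α β : Type*} [MeasurableSpace Ω] [MeasurableSpace α]
    [MeasurableSpace β] {P : Measure Ω} [IsProbabilityMeasure P] {U : Ω → α} {V : Ω → β}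
    (hU : Measurable U) (hV : Measurable V) (hUV : IndepFun U V P) {B : Set (α × β)}
    (hB : MeasurableSet B) :
    P {ω | (U ω, V ω) ∈ B} = ∫⁻ ω', P {ω | (U ω, V ω') ∈ B} ∂P := by
  have hprod := (indepFun_iff_map_prod_eq_prod_map_map hU.aemeasurable hV.aemeasurable).1 hUV
  have := Measure.isProbabilityMeasure_map (μ := P) hU.aemeasurable
  have h1 : P {ω | (U ω, V ω) ∈ B} = P.map (fun ω => (U ω, V ω)) B :=
    (Measure.map_apply (hU.prodMk hV) hB).symm
  rw [h1, hprod, Measure.prod_apply_symm hB,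
    lintegral_map (measurable_measure_prodMk_right hB) hV]
  refine lintegral_congr fun ω' => ?_
  exact Measure.map_apply hU (measurable_prodMk_right hB)

/-- No integrability hypothesis is needed: the Bochner integral of a non-integrable function
is `0`. -/
lemma lintegral_enorm_eq_one {Ω₀ : Type*} [MeasurableSpace Ω₀] {P₀ : Measure Ω₀}
    {W : Ω₀ → ℝ} (hnn : ∀ᵐ ω ∂P₀, 0 ≤ W ω) (hmean : ∫ ω, W ω ∂P₀ = 1) : ∫⁻ ω, ‖W ω‖ₑ ∂P₀ = 1 := by
  have hint : Integrable W P₀ := by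
    by_contra h
    rw [integral_undef h] at hmean
    exact zero_ne_one hmean
  rw [lintegral_congr_ae (g := fun ω => ENNReal.ofReal (W ω)) (by
      filter_upwards [hnn] with ω hω using Real.enorm_of_nonneg hω),
    ← ofReal_integral_eq_lintegral_ofReal hint hnn, hmean, ENNReal.ofReal_one]

lemma lintegral_ellNorm_lt_top {S Ω₀ : Type*} [MeasurableSpace Ω₀] {P₀ : Measure Ω₀}
    {p : ℝ≥0∞} {W₀ : S → Ω₀ → ℝ} (hp : 1 < p) (hW₀_meas : ∀ s, Measurable (W₀ s))
    (hW₀_nonneg : ∀ s, ∀ᵐ ω ∂P₀, 0 ≤ W₀ s ω) (hW₀_mean : ∀ s, ∫ ω, W₀ s ω ∂P₀ = 1)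
    {ι : Type*} [Fintype ι] (s : ι → S) (x : ι → ℝ) :
    ∫⁻ ω, ellNorm p (fun k => W₀ (s k) ω / x k) ∂P₀ < ∞ := by
  refine (lintegral_mono fun ω => ellNorm_le_sum hp _).trans_lt ?_
  rw [lintegral_finsetSum _ fun k _ => by fun_prop]
  refine ENNReal.sum_lt_top.2 fun k _ => ?_
  simp_rw [div_eq_mul_inv, enorm_mul]
  rw [lintegral_mul_const _ (hW₀_meas _).enorm,
    lintegral_enorm_eq_one (hW₀_nonneg _) (hW₀_mean _), one_mul]
  exact enorm_lt_top

lemma gamma_one_sub_inv_pos {p : ℝ≥0∞} (hp : 1 < p) : 0 < Real.Gamma (1 - p⁻¹.toReal) := by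
  refine Real.Gamma_pos_of_pos (sub_pos.2 ?_)
  rw [← ENNReal.toReal_one]
  exact (ENNReal.toReal_lt_toReal (ENNReal.inv_ne_top.2 (zero_lt_one.trans hp).ne')
    ENNReal.one_ne_top).2 (ENNReal.inv_lt_one.2 hp)

section FiniteDimensional

variable {S Ω Ω₀ : Type*} [MeasurableSpace Ω] {P : Measure Ω} [IsProbabilityMeasure P]
  [MeasurableSpace Ω₀] {P₀ : Measure Ω₀} [IsProbabilityMeasure P₀] {p : ℝ≥0∞}
  {U : S → Ω → ℝ} {A : ℕ → Ω → ℝ} {W : ℕ → S → Ω → ℝ} {W₀ : S → Ω₀ → ℝ}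

/-- The joint Laplace transform of the `p`-th powers of the norms (for `p = ∞`, their joint
distribution function): by the choice of the gauge the exponent is a sum over the marked Poisson
process of a function of `‖A i‖` times an `ℓ^p` norm over the index set `ι`. -/
lemma lintegral_negExp_sum_frechetGauge (hp : 1 < p) (hA : IsPoissonProcess A invSqIntensity P)
    (hW₀_meas : ∀ s, Measurable (W₀ s)) (hW_meas : ∀ i s, Measurable (W i s))
    (hW_copy : ∀ i, processLaw (W i) P = processLaw W₀ P₀)
    (hW_indep : iIndepFun (fun i ω s => W i s ω) P)
    (hAW : IndepFun (fun ω i => A i ω) (fun ω i s => W i s ω) P)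
    {ι : Type*} [Fintype ι] (s : ι → S) {c : ι → ℝ} (hc : ∀ k, 0 ≤ c k) :
    ∫⁻ ω, negExp (∑ k, frechetGauge p (ENNReal.ofReal (c k) *
        ellNorm p fun i => A i ω * W i (s k) ω)) ∂P =
      negExp (ENNReal.ofReal (Real.Gamma (1 - p⁻¹.toReal)) *
        ∫⁻ ω, ellNorm p (fun k => c k * W₀ (s k) ω) ∂P₀) := by
  have hW₀m : Measurable fun ω s => W₀ s ω := measurable_pi_lambda _ hW₀_meas
  have hWm : ∀ i, Measurable fun ω s => W i s ω := fun i => measurable_pi_lambda _ (hW_meas i)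
  have : IsProbabilityMeasure (processLaw W₀ P₀) :=
    Measure.isProbabilityMeasure_map hW₀m.aemeasurable
  have hV : Measurable fun w : S → ℝ => ellNorm p fun k => c k * w (s k) :=
    measurable_ellNorm p fun k => by fun_prop
  have hφ : Measurable (Function.uncurry fun (a : ℝ) (w : S → ℝ) =>
      frechetGauge p (‖a‖ₑ * ellNorm p fun k => c k * w (s k))) := by
    refine (measurable_frechetGauge p).comp (Measurable.mul (by fun_prop) ?_)
    exact hV.comp measurable_snd
  -- The gauge identity over the points, an exchange of sums, and the gauge identity over `ι`.
  have hpt : ∀ ω, ∑ k, frechetGauge p (ENNReal.ofReal (c k) *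
      ellNorm p fun i => A i ω * W i (s k) ω) =
      ∑' i, frechetGauge p (‖A i ω‖ₑ * ellNorm p fun k => c k * W i (s k) ω) := by
    intro ω
    simp_rw [frechetGauge_mul_ellNorm hp, tsum_fintype]
    rw [← Summable.tsum_finsetSum fun _ _ => ENNReal.summable]
    refine tsum_congr fun i => Finset.sum_congr rfl fun k _ => ?_
    rw [enorm_mul, enorm_mul, Real.enorm_of_nonneg (hc k)]
    congr 1
    ring
  simp_rw [hpt]
  rw [hA.lintegral_negExp_tsum_marked hWm hW_indep hW_copy hAW hφ, lintegral_lintegral_swap]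
  · simp_rw [lintegral_one_sub_negExp_frechetGauge hp (ellNorm_ne_top hp _)]
    rw [lintegral_const_mul _ hV, processLaw, lintegral_map hV hW₀m]
  · exact (measurable_const.sub (measurable_negExp.comp hφ)).aemeasurable

/-- Letting the argument of the Laplace transform of the norm tend to zero shows that the norm is
almost surely finite. -/
lemma ae_ellNorm_lt_top (hp : 1 < p) (hA : IsPoissonProcess A invSqIntensity P)
    (hW₀_meas : ∀ s, Measurable (W₀ s)) (hW₀_nonneg : ∀ s, ∀ᵐ ω ∂P₀, 0 ≤ W₀ s ω)
    (hW₀_mean : ∀ s, ∫ ω, W₀ s ω ∂P₀ = 1) (hW_meas : ∀ i s, Measurable (W i s))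
    (hW_copy : ∀ i, processLaw (W i) P = processLaw W₀ P₀)
    (hW_indep : iIndepFun (fun i ω s => W i s ω) P)
    (hAW : IndepFun (fun ω i => A i ω) (fun ω i s => W i s ω) P) (s : S) :
    ∀ᵐ ω ∂P, ellNorm p (fun i => A i ω * W i s ω) < ∞ := by
  have hm : ∀ i, Measurable (A i) := hA.measurable
  have hNm : Measurable fun ω => ellNorm p (fun i => A i ω * W i s ω) :=
    measurable_ellNorm p fun i => (hm i).mul (hW_meas i s)
  have hset : MeasurableSet {ω | ellNorm p (fun i => A i ω * W i s ω) < ∞} :=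
    measurableSet_lt hNm measurable_const
  have hle : ∀ c : ℝ, 0 < c → negExp (ENNReal.ofReal (Real.Gamma (1 - p⁻¹.toReal)) *
      ENNReal.ofReal c) ≤ P {ω | ellNorm p (fun i => A i ω * W i s ω) < ∞} := by
    intro c hc
    have h := lintegral_negExp_sum_frechetGauge hp hA hW₀_meas hW_meas hW_copy hW_indep hAW
      (fun _ : Unit => s) (c := fun _ => c) fun _ => hc.le
    simp_rw [ellNorm_unique hp, enorm_mul] at h
    rw [lintegral_const_mul _ (hW₀_meas s).enorm, lintegral_enorm_eq_one (hW₀_nonneg s)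
      (hW₀_mean s), mul_one, Real.enorm_of_nonneg hc.le] at h
    rw [← h, ← lintegral_indicator_one hset]
    refine lintegral_mono fun ω => ?_
    by_cases hω : ellNorm p (fun i => A i ω * W i s ω) < ∞
    · rw [indicator_of_mem (by exact hω)]
      exact negExp_le_one _
    · -- An infinite norm contributes nothing to the Laplace transform.
      rw [not_lt, top_le_iff] at hω
      simp [hω, ENNReal.mul_top, hc, frechetGauge_top hp]
  have hlim : Filter.Tendsto (fun c : ℝ => negExp (ENNReal.ofReal (Real.Gamma (1 - p⁻¹.toReal)) *
      ENNReal.ofReal c)) (nhdsWithin 0 (Ioi 0)) (nhds 1) := by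
    have h0 : Filter.Tendsto (fun c : ℝ => ENNReal.ofReal (Real.Gamma (1 - p⁻¹.toReal)) *
        ENNReal.ofReal c) (nhds 0) (nhds 0) := by
      have := ENNReal.Tendsto.const_mul (a := ENNReal.ofReal (Real.Gamma (1 - p⁻¹.toReal)))
        (ENNReal.continuous_ofReal.tendsto 0) (Or.inr ENNReal.ofReal_ne_top)
      simpa using this
    have := (continuous_negExp.tendsto 0).comp h0
    rw [negExp_zero] at this
    exact this.mono_left nhdsWithin_le_nhds
  have h1 : 1 ≤ P {ω | ellNorm p (fun i => A i ω * W i s ω) < ∞} :=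
    le_of_tendsto hlim (by filter_upwards [self_mem_nhdsWithin] with c hc using hle c hc)
  exact (mem_ae_iff_prob_eq_one hset).2 (le_antisymm prob_le_one h1)

lemma measurable_lpProcess (hU : ∀ s, Measurable (U s)) (hA : ∀ i, Measurable (A i))
    (hW : ∀ i s, Measurable (W i s)) (s : S) : Measurable (lpProcess p U A W s) :=
  ((hU s).div_const _).mul
    (measurable_ellNorm p fun i => (hA i).mul (hW i s)).ennreal_toReal

/-- The finite-dimensional distribution functions at positive arguments. Given the points and the
marks, the noise contributes a product of Fréchet distribution functions, which is the integrand of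
`lintegral_negExp_sum_frechetGauge`. -/
theorem measure_lpProcess_le (hp : 1 < p) (hU : ∀ s, IsFrechet p (U s) P)
    (hU_indep : iIndepFun U P) (hA : IsPoissonProcess A invSqIntensity P)
    (hW₀_meas : ∀ s, Measurable (W₀ s)) (hW₀_nonneg : ∀ s, ∀ᵐ ω ∂P₀, 0 ≤ W₀ s ω)
    (hW₀_mean : ∀ s, ∫ ω, W₀ s ω ∂P₀ = 1) (hW_meas : ∀ i s, Measurable (W i s))
    (hW_copy : ∀ i, processLaw (W i) P = processLaw W₀ P₀)
    (hW_indep : iIndepFun (fun i ω s => W i s ω) P)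
    (hAW : IndepFun (fun ω i => A i ω) (fun ω i s => W i s ω) P)
    (hU_AW : IndepFun (fun ω s => U s ω)
      (fun ω => ((fun i => A i ω), (fun i s => W i s ω))) P)
    {ι : Type*} [Fintype ι] {s : ι → S} (hs : Function.Injective s) {x : ι → ℝ}
    (hx : ∀ k, 0 < x k) :
    P {ω | ∀ k, lpProcess p U A W (s k) ω ≤ x k} =
      negExp (∫⁻ ω, ellNorm p (fun k => W₀ (s k) ω / x k) ∂P₀) := by
  have hg := gamma_one_sub_inv_pos hp
  set g := Real.Gamma (1 - p⁻¹.toReal) with hgdef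
  have hmA : Measurable fun ω i => A i ω := measurable_pi_lambda _ hA.measurable
  have hmW : Measurable fun ω i s => W i s ω :=
    measurable_pi_lambda _ fun i => measurable_pi_lambda _ (hW_meas i)
  have hmU : Measurable fun ω s => U s ω := measurable_pi_lambda _ fun s => (hU s).measurable
  have hB : MeasurableSet {q : (S → ℝ) × (ℕ → ℝ) × (ℕ → S → ℝ) | ∀ k, q.1 (s k) / g *
      (ellNorm p fun i => q.2.1 i * q.2.2 i (s k)).toReal ≤ x k} := by
    rw [ofPred_forall]
    refine MeasurableSet.iInter fun k => measurableSet_le (Measurable.mul (by fun_prop) ?_)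
      measurable_const
    exact (measurable_ellNorm p fun i => by fun_prop).ennreal_toReal
  have hcond := measure_eq_lintegral_of_indepFun hmU (hmA.prodMk hmW) hU_AW hB
  have hfin : ∀ᵐ ω ∂P, ∀ k, ellNorm p (fun i => A i ω * W i (s k) ω) < ∞ :=
    ae_all_iff.2 fun k => ae_ellNorm_lt_top hp hA hW₀_meas hW₀_nonneg hW₀_mean hW_meas hW_copy
      hW_indep hAW (s k)
  have hnoise : ∀ᵐ ω' ∂P, P {ω | ∀ k, U (s k) ω / g *
      (ellNorm p fun i => A i ω' * W i (s k) ω').toReal ≤ x k} =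
      negExp (∑ k, frechetGauge p (ENNReal.ofReal (g * x k)⁻¹ *
        ellNorm p fun i => A i ω' * W i (s k) ω')) := by
    filter_upwards [hfin] with ω' hω'
    have hind := (hU_indep.precomp hs).measure_inter_preimage_eq_mul Finset.univ
      (sets := fun k => {u : ℝ | u / g *
        (ellNorm p fun i => A i ω' * W i (s k) ω').toReal ≤ x k})
      fun k _ => measurableSet_le (by fun_prop) measurable_const
    rw [negExp_sum, ofPred_forall]
    simp only [Finset.mem_univ, iInter_true] at hind
    refine hind.trans (Finset.prod_congr rfl fun k _ => ?_)
    exact (hU (s k)).measure_mul_le hp hg (hx k) (hω' k).ne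
  -- The factor `g⁻¹` cancels the constant `g` in the exponent.
  have hscale : ∀ ω, ellNorm p (fun k => (g * x k)⁻¹ * W₀ (s k) ω) =
      ENNReal.ofReal g⁻¹ * ellNorm p (fun k => W₀ (s k) ω / x k) := by
    intro ω
    rw [← Real.enorm_of_nonneg (inv_nonneg.2 hg.le), ← ellNorm_const_mul hp]
    congr 1
    funext k
    rw [mul_inv, div_eq_mul_inv]
    ring
  refine hcond.trans ?_
  refine (lintegral_congr_ae hnoise).trans ?_
  rw [lintegral_negExp_sum_frechetGauge hp hA hW₀_meas hW_meas hW_copy hW_indep hAW s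
    (c := fun k => (g * x k)⁻¹) fun k => inv_nonneg.2 (mul_pos hg (hx k)).le]
  simp_rw [hscale]
  rw [lintegral_const_mul' _ _ ENNReal.ofReal_ne_top, ← mul_assoc, ← hgdef,
    ← ENNReal.ofReal_mul hg.le, mul_inv_cancel₀ hg.ne', ENNReal.ofReal_one, one_mul]

end FiniteDimensional

/-- A real random variable with the unit Fréchet distribution function on `(0, ∞)` puts no mass on
`(-∞, 0]`. -/
lemma measure_le_eq_zero_of_nonpos {Ω : Type*} [MeasurableSpace Ω] {P : Measure Ω} {Y : Ω → ℝ}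
    (hY : ∀ x : ℝ, 0 < x → P {ω | Y ω ≤ x} = negExp (ENNReal.ofReal x⁻¹)) {x : ℝ} (hx : x ≤ 0) :
    P {ω | Y ω ≤ x} = 0 := by
  have hlim : Filter.Tendsto (fun y : ℝ => negExp (ENNReal.ofReal y⁻¹)) (nhdsWithin 0 (Ioi 0))
      (nhds 0) := by
    have := (continuous_negExp.tendsto ∞).comp
      (ENNReal.tendsto_ofReal_atTop.comp (tendsto_inv_nhdsGT_zero (𝕜 := ℝ)))
    rwa [negExp_top] at this
  refine le_antisymm (ge_of_tendsto hlim ?_) zero_le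
  filter_upwards [self_mem_nhdsWithin] with y hy
  rw [← hY y hy]
  exact measure_mono fun ω hω => le_trans hω (hx.trans (le_of_lt hy))

end LpMaxStable

theorem mainTheorem2 {S Ω Ω₀ : Type*} [Countable S]
    [MeasurableSpace Ω] (P : Measure Ω) [IsProbabilityMeasure P]
    [MeasurableSpace Ω₀] (P₀ : Measure Ω₀) [IsProbabilityMeasure P₀]
    (p : ℝ≥0∞) (hp : 1 < p)
    (U : S → Ω → ℝ) (A : ℕ → Ω → ℝ) (W : ℕ → S → Ω → ℝ) (W₀ : S → Ω₀ → ℝ)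
    -- the noise `U`: independent `p`-Fréchet random variables
    (hU : ∀ s, LpMaxStable.IsFrechet p (U s) P)
    (hU_indep : iIndepFun U P)
    -- the Poisson process
    (hA : LpMaxStable.IsPoissonProcess A LpMaxStable.invSqIntensity P)
    -- the nonnegative process `W₀` with mean one, and its independent copies `W i`
    (hW₀_meas : ∀ s, Measurable (W₀ s))
    (hW₀_nonneg : ∀ s, ∀ᵐ ω ∂P₀, 0 ≤ W₀ s ω)
    (hW₀_mean : ∀ s, ∫ ω, W₀ s ω ∂P₀ = 1)
    (hW_meas : ∀ i s, Measurable (W i s))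
    (hW_copy : ∀ i, LpMaxStable.processLaw (W i) P = LpMaxStable.processLaw W₀ P₀)
    (hW_indep : iIndepFun (fun i ω s => W i s ω) P)
    -- `U`, `A` and `(W i)_i` are mutually independent
    (hAW : IndepFun (fun ω i => A i ω) (fun ω i s => W i s ω) P)
    (hU_AW : IndepFun (fun ω s => U s ω)
      (fun ω => ((fun i => A i ω), (fun i s => W i s ω))) P) :
    (∀ s, ∀ᵐ ω ∂P, LpMaxStable.ellNorm p (fun i => A i ω * W i s ω) < ∞) ∧
    LpMaxStable.IsSimpleMaxStable (LpMaxStable.lpProcess p U A W) P ∧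
    ∀ (n : ℕ) (s : Fin n → S), Function.Injective s →
      ∀ x : Fin n → ℝ, (∀ i, 0 < x i) →
        ∫⁻ ω, LpMaxStable.ellNorm p (fun i => W₀ (s i) ω / x i) ∂P₀ < ∞ ∧
        P.real {ω | ∀ i, LpMaxStable.lpProcess p U A W (s i) ω ≤ x i} =
          Real.exp (-(∫⁻ ω, LpMaxStable.ellNorm p (fun i => W₀ (s i) ω / x i) ∂P₀).toReal) := by
  have hmX : ∀ s, Measurable (LpMaxStable.lpProcess p U A W s) :=
    LpMaxStable.measurable_lpProcess (fun s => (hU s).measurable) hA.measurable hW_meas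
  -- The finite-dimensional distributions at positive arguments.
  have hfdd : ∀ (t : Finset S) (x : S → ℝ), (∀ s ∈ t, 0 < x s) →
      P {ω | ∀ s ∈ t, LpMaxStable.lpProcess p U A W s ω ≤ x s} =
        LpMaxStable.negExp (∫⁻ ω, LpMaxStable.ellNorm p (fun k : t => W₀ k ω / x k) ∂P₀) := by
    intro t x hx
    rw [← LpMaxStable.measure_lpProcess_le hp hU hU_indep hA hW₀_meas hW₀_nonneg hW₀_mean hW_meas
      hW_copy hW_indep hAW hU_AW Subtype.val_injective (x := fun k : t => x k) fun k => hx k k.2]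
    simp
  have hmargin : ∀ s (x : ℝ), 0 < x → P {ω | LpMaxStable.lpProcess p U A W s ω ≤ x} =
      LpMaxStable.negExp (ENNReal.ofReal x⁻¹) := by
    intro s x hx
    have h := LpMaxStable.measure_lpProcess_le hp hU hU_indep hA hW₀_meas hW₀_nonneg hW₀_mean
      hW_meas hW_copy hW_indep hAW hU_AW (s := fun _ : Unit => s) (x := fun _ => x)
      (fun _ _ _ => rfl) fun _ => hx
    simp_rw [LpMaxStable.ellNorm_unique hp, div_eq_mul_inv, enorm_mul] at h
    rw [lintegral_mul_const _ (hW₀_meas s).enorm,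
      LpMaxStable.lintegral_enorm_eq_one (hW₀_nonneg s) (hW₀_mean s), one_mul,
      Real.enorm_of_nonneg (inv_nonneg.2 hx.le)] at h
    simpa using h
  have hzero : ∀ (t : Finset S) (x : S → ℝ), (∃ s ∈ t, x s ≤ 0) →
      P {ω | ∀ s ∈ t, LpMaxStable.lpProcess p U A W s ω ≤ x s} = 0 := by
    rintro t x ⟨s, hs, hxs⟩
    exact measure_mono_null (fun ω hω => hω s hs)
      (LpMaxStable.measure_le_eq_zero_of_nonpos (hmargin s) hxs)
  refine ⟨LpMaxStable.ae_ellNorm_lt_top hp hA hW₀_meas hW₀_nonneg hW₀_mean hW_meas hW_copy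
    hW_indep hAW, ⟨LpMaxStable.isMaxStable_of_pow hmX fun n hn t x => ?_, fun s => ⟨hmX s,
    fun x => ?_⟩⟩, fun n s hs x hx => ⟨LpMaxStable.lintegral_ellNorm_lt_top hp hW₀_meas hW₀_nonneg
    hW₀_mean s x, ?_⟩⟩
  · have hn0 : (0 : ℝ) < n := by exact_mod_cast hn
    by_cases hx : ∀ s ∈ t, 0 < x s
    · -- The exponent is homogeneous of degree `-1` in `x`.
      have hscale : ∀ ω, LpMaxStable.ellNorm p (fun k : t => W₀ k ω / (n * x k)) =
          (n : ℝ≥0∞)⁻¹ * LpMaxStable.ellNorm p (fun k : t => W₀ k ω / x k) := by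
        intro ω
        have hn' : ‖(n : ℝ)⁻¹‖ₑ = (n : ℝ≥0∞)⁻¹ := by
          rw [Real.enorm_of_nonneg (inv_nonneg.2 hn0.le), ENNReal.ofReal_inv_of_pos hn0,
            ENNReal.ofReal_natCast]
        rw [← hn', ← LpMaxStable.ellNorm_const_mul hp]
        congr 1
        funext k
        rw [div_mul_eq_div_div_swap, div_eq_inv_mul]
      have hn1 : (n : ℝ≥0∞) ≠ 0 := by
        simpa using (Nat.pos_of_ne_zero (Nat.one_le_iff_ne_zero.1 hn)).ne'
      rw [hfdd t (fun s => n * x s) fun s hs => mul_pos hn0 (hx s hs), hfdd t x hx]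
      simp_rw [hscale]
      rw [lintegral_const_mul' _ _ (ENNReal.inv_ne_top.2 hn1), ← Finset.card_range n,
        ← Finset.prod_const, ← LpMaxStable.negExp_sum, Finset.sum_const, Finset.card_range,
        nsmul_eq_mul, ← mul_assoc, ENNReal.mul_inv_cancel hn1 (ENNReal.natCast_ne_top n), one_mul]
    · push Not at hx
      obtain ⟨s, hs, hxs⟩ := hx
      rw [hzero t x ⟨s, hs, hxs⟩, hzero t (fun s => n * x s)
        ⟨s, hs, mul_nonpos_of_nonneg_of_nonpos hn0.le hxs⟩,
        zero_pow (Nat.one_le_iff_ne_zero.1 hn)]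
  · rcases le_or_gt x 0 with hx | hx
    · have h0 : P.real {ω | LpMaxStable.lpProcess p U A W s ω ≤ x} = 0 := by
        rw [measureReal_def, LpMaxStable.measure_le_eq_zero_of_nonpos (hmargin s) hx,
          ENNReal.toReal_zero]
      simp [h0, LpMaxStable.frechetCDF, hx.not_gt]
    · rw [measureReal_def, hmargin s x hx, LpMaxStable.negExp_ofReal (inv_nonneg.2 hx.le),
        ENNReal.toReal_ofReal (Real.exp_nonneg _)]
      simp [LpMaxStable.frechetCDF, hx, Real.rpow_neg_one]
  · rw [measureReal_def, LpMaxStable.measure_lpProcess_le hp hU hU_indep hA hW₀_meas hW₀_nonneg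
      hW₀_mean hW_meas hW_copy hW_indep hAW hU_AW hs hx, LpMaxStable.negExp_of_ne_top
      (LpMaxStable.lintegral_ellNorm_lt_top hp hW₀_meas hW₀_nonneg hW₀_mean s x).ne,
      ENNReal.toReal_ofReal (Real.exp_nonneg _)]
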